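/- Let $\mathcal C$ be a combinatorial class, i.e. a set of objects each having a size in $\{1,2,3,\dots\}$, with a finite number $c_k$ of objects of size $k$ for every $k\ge 1$; put $c_0:=0$. Suppose that the counting sequence is subexponential, i.e. that there is a real $\rho>0$ such that, with $C(x)=\sum_{k\ge1}c_kx^k$, $$\frac{c_{n-1}}{c_n}\to\rho,\qquad C(\rho)<\infty\qquad\text{and}\qquad \frac1{c_n}\sum_{0\le k\le n}c_kc_{n-k}\to 2C(\rho)\qquad(n\to\infty).$$ Let $m=\min\{k\ge 1: c_k>0\}$. For $n,N\ge1$ let $\mathcal G_{n,N}$ be the set of all multisets of objects of $\mathcal C$ that consist of exactly $N$ components (counted with multiplicity) and whose component sizes, counted with multiplicity, add up to $n$. Whenever $\mathcal G_{n,N}$ is non-empty, let $\mathsf G_{n,N}$ be drawn uniformly at random from the finite set $\mathcal G_{n,N}$, and let $\mathcal L(\mathsf G_{n,N})$ be the size of a largest component of $\mathsf G_{n,N}$. Then, as $n$, $N$ and $n-mN$ all tend to infinity, $\mathcal G_{n,N}$ is eventually non-empty and $$\mathcal L(\mathsf G_{n,N})=n-mN+\mathcal O_p(1),$$ that is, for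 every $\varepsilon>0$ there are $K>0$ and $B$ such that $\mathcal G_{n,N}\ne\emptyset$ and $\Pr\big[\,|\mathcal L(\mathsf G_{n,N})-(n-mN)|\ge K\,\big]\le\varepsilon$ for all $n,N$ with $n\ge B$, $N\ge B$ and $n-mN\ge B$. -/

import Mathlib

open Filter Topology MeasureTheory ProbabilityTheory

/-- A combinatorial class: a set of objects, each with a size in `{1, 2, 3, …}`, with only
finitely many objects of every given size (in particular the set of objects is countable). -/
structure CombClass where
  /-- the objects -/
  Obj : Type*
  /-- the size of an object -/
  size : Obj → ℕ
  size_pos : ∀ c, 0 < size c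
  finite_size_eq : ∀ n, {c | size c = n}.Finite

/-- `c : ℕ → ℝ` (that is, the power series `∑ k, c k * x ^ k`) is subexponential with radius of
convergence `ρ`: the coefficients are non-negative, `ρ > 0`, `c (n - 1) / c n → ρ`, the value
`C(ρ) = ∑ k, c k * ρ ^ k` is finite, and `(∑_{k ≤ n} c k * c (n - k)) / c n → 2 * C(ρ)`.
As `ρ ≠ 0`, the first limit forces `c n ≠ 0` for all large `n`. -/
structure IsSubexponential (c : ℕ → ℝ) (ρ : ℝ) : Prop where
  nonneg : ∀ k, 0 ≤ c k
  pos : 0 < ρ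
  tendsto_ratio : Tendsto (fun n : ℕ => c n / c (n + 1)) atTop (𝓝 ρ)
  summable : Summable fun k : ℕ => c k * ρ ^ k
  tendsto_conv : Tendsto (fun n : ℕ => (∑ k ∈ Finset.range (n + 1), c k * c (n - k)) / c n)
    atTop (𝓝 (2 * ∑' k : ℕ, c k * ρ ^ k))

/-- The discrete σ-algebra on finite multisets. -/
instance Multiset.discreteMeasurableSpace (α : Type*) : MeasurableSpace (Multiset α) := ⊤

namespace CombClass

/-- The counting sequence: the number of objects of size `k`. -/
noncomputable def count (C : CombClass) (k : ℕ) : ℕ := {c : C.Obj | C.size c = k}.ncard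

/-- The smallest size of an object of the class. -/
noncomputable def minSize (C : CombClass) : ℕ := sInf {k | 0 < C.count k}

/-- The size of a multiset of objects: the sum of the sizes of its components, counted with
multiplicity. -/
def totalSize (C : CombClass) (G : Multiset C.Obj) : ℕ := (G.map C.size).sum

/-- The size of a largest component of a multiset of objects. -/
def largest (C : CombClass) (G : Multiset C.Obj) : ℕ := (G.map C.size).sup

/-- The set of multisets of objects with total size `n` and exactly `N` components
(counted with multiplicity). -/
def msets (C : CombClass) (n N : ℕ) : Set (Multiset C.Obj) :=
  {G | C.totalSize G = n ∧ Multiset.card G = N}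

/-- The law of a multiset drawn uniformly at random from `C.msets n N`. -/
noncomputable def uniformLaw (C : CombClass) (n N : ℕ) : Measure (Multiset C.Obj) :=
  uniformOn (C.msets n N)

end CombClass

/-- The filter on pairs `(n, N)` expressing that `n → ∞`, `N → ∞` and `n - m * N → ∞`. -/
noncomputable def jointlyToInfinity (m : ℕ) : Filter (ℕ × ℕ) :=
  comap (fun p => p.1) atTop ⊓ comap (fun p => p.2) atTop ⊓
    comap (fun p => (p.1 : ℤ) - (m : ℤ) * (p.2 : ℤ)) atTop

/-- The real-valued functions `X i`, considered under the laws `μ i`, are `O_p(1)` (bounded in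
probability) along the filter `F`. -/
def IsBoundedInProbability {ι Ω : Type*} [MeasurableSpace Ω] (F : Filter ι)
    (μ : ι → Measure Ω) (X : ι → Ω → ℝ) : Prop :=
  ∀ ε : ℝ, 0 < ε → ∃ K : ℝ, 0 < K ∧ ∀ᶠ i in F, (μ i).real {ω | K ≤ |X i ω|} ≤ ε

/-!
The proof rests on the principle of a single big jump. Let `m` be the minimal size, call
`size - m` the excess of an object, let `b k` be the number of objects of excess `k`, and put
`M = n - m * N`. A multiset of `N` objects of total size `n` consists of components of positive
excess, whose excesses add up to `M`, and of objects of minimal size. Let `z` be the number of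
multisets of `N - 1` objects of minimal size. One object of excess `M` together with `N - 1` objects
of minimal size gives `b M * z` multisets (`CombClass.count_mul_ncard_minMsets_le`). Conversely, a
multiset without a component of excess greater than `M - K` is determined by its part of positive
excess and, after padding, by one of the same `z` multisets (`CombClass.ncard_msets_excess_le`).
Hence `N` drops out, and it suffices that the number of multisets of total excess `M`, of any number
of components, all of positive excess at most `M - K`, is at most `ε * b M`
(`exists_ncard_no_giant_le`).

For this, subexponentiality is used in two forms. The sum of `b k * b (n - k)` over
`K ≤ k ≤ n - K` is at most `ε * b n` for `K` large (`IsSubexponential.exists_sum_Icc_shift_le`), and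
`b (n - i)` is at most of order `y ^ i * b n` for every `y > ρ` (`exists_sub_le_of_tendsto_ratio`);
as the `b k` are integers, `ρ < 1`, so that `ρ < y < x < 1` is possible.
* Multisets of total excess `n` with all components of excess at least `K` number at most `2 * b n`,
  by removing a component and induction on `n` (`ncard_msetsOfWeight_ge_le`).
* Multisets with components from a finite set number at most `A * x⁻¹ ^ n`
  (`exists_ncard_msetsOfWeight_le_of_finite`), which is negligible against `b n`.
* Combining the two, all multisets of total excess `n` number at most `A * b n`
  (`exists_ncard_msetsOfWeight_le`).
* In a multiset without a giant component, either all components are bounded, or one of excess `k`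
  with `K ≤ k ≤ n - K` can be removed; the latter case contributes at most
  `A * ∑ b k * b (n - k)`, a small multiple of `b n`.
-/

/-! ### Multisets of given total weight -/

section Multisets

variable {α : Type*} {s : α → ℕ}

/-- The finite multisets of elements of `S` whose weights `s` add up to `n`. -/
def msetsOfWeight (s : α → ℕ) (S : Set α) (n : ℕ) : Set (Multiset α) :=
  {H | (∀ a ∈ H, a ∈ S) ∧ (H.map s).sum = n}

lemma finite_multiset_card_le {F : Set α} (hF : F.Finite) (n : ℕ) :
    {H : Multiset α | (∀ a ∈ H, a ∈ F) ∧ Multiset.card H ≤ n}.Finite := by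
  classical
  refine (Multiset.powerset (n • hF.toFinset.val)).toFinset.finite_toSet.subset ?_
  rintro H ⟨hH, hn⟩
  simp only [Finset.mem_coe, Multiset.mem_toFinset, Multiset.mem_powerset, Multiset.le_iff_count]
  intro a
  by_cases ha : a ∈ H
  · rw [Multiset.count_nsmul, Multiset.count_eq_one_of_mem hF.toFinset.nodup
      (by simpa using hH a ha)]
    simpa using (Multiset.count_le_card a H).trans hn
  · simp [Multiset.count_eq_zero_of_notMem ha]

lemma le_sum_map {H : Multiset α} {a : α} (ha : a ∈ H) : s a ≤ (H.map s).sum :=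
  Multiset.single_le_sum (fun _ _ => Nat.zero_le _) _ (Multiset.mem_map_of_mem s ha)

lemma finite_weight_le (hs : ∀ j, {a | s a = j}.Finite) (n : ℕ) : {a | s a ≤ n}.Finite := by
  refine ((Set.finite_Iic n).biUnion fun j _ => hs j).subset fun a ha => ?_
  simpa using ha

lemma card_le_sum_map {H : Multiset α} (hH : ∀ a ∈ H, 0 < s a) :
    Multiset.card H ≤ (H.map s).sum := by
  simpa using Multiset.sum_map_le_sum_map (fun _ => 1) s hH

lemma finite_msetsOfWeight (hs : ∀ j, {a | s a = j}.Finite) {S : Set α} (hS : ∀ a ∈ S, 0 < s a)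
    (n : ℕ) : (msetsOfWeight s S n).Finite := by
  refine (finite_multiset_card_le (finite_weight_le hs n) n).subset ?_
  rintro H ⟨hH, rfl⟩
  exact ⟨fun a ha => le_sum_map ha, card_le_sum_map fun a ha => hS a (hH a ha)⟩

/-- A union bound over the weight of a removed component, in case every multiset of `X` has a
component with weight in `I`. -/
lemma ncard_le_sum_remove (hs : ∀ j, {a | s a = j}.Finite) {S : Set α} (hS : ∀ a ∈ S, 0 < s a)
    {n : ℕ} {X : Set (Multiset α)} (hX : X ⊆ msetsOfWeight s S n) (I : Finset ℕ)
    (hI : ∀ H ∈ X, ∃ a ∈ H, s a ∈ I) :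
    X.ncard ≤ ∑ j ∈ I, {a | s a = j}.ncard * (msetsOfWeight s S (n - j)).ncard := by
  have hfin : ∀ j, ({a | s a = j} ×ˢ msetsOfWeight s S (n - j)).Finite := fun j =>
    (hs j).prod (finite_msetsOfWeight hs hS _)
  have hsub : X ⊆ ⋃ j ∈ I, (fun p : α × Multiset α => p.1 ::ₘ p.2) ''
      ({a | s a = j} ×ˢ msetsOfWeight s S (n - j)) := by
    intro H hH
    obtain ⟨a, ha, haI⟩ := hI H hH
    obtain ⟨H', rfl⟩ := Multiset.exists_cons_of_mem ha
    obtain ⟨h1, h2⟩ := hX hH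
    simp only [Set.mem_iUnion]
    refine ⟨s a, haI, (a, H'), ⟨rfl, fun b hb => h1 b (Multiset.mem_cons_of_mem hb), ?_⟩, rfl⟩
    simp at h2 ⊢
    omega
  refine (Set.ncard_le_ncard hsub
    (I.finite_toSet.biUnion fun j _ => (hfin j).image _)).trans ?_
  refine (Finset.set_ncard_biUnion_le _ _).trans (Finset.sum_le_sum fun j _ => ?_)
  exact (Set.ncard_image_le (hfin j)).trans Set.ncard_prod.le

/-- Splitting a multiset over `S ∪ T` into a multiset over `S` and one over `T`. -/
lemma ncard_msetsOfWeight_union_le (hs : ∀ j, {a | s a = j}.Finite) {S T : Set α}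
    (hS : ∀ a ∈ S, 0 < s a) (hT : ∀ a ∈ T, 0 < s a) (n : ℕ) :
    (msetsOfWeight s (S ∪ T) n).ncard ≤ ∑ i ∈ Finset.range (n + 1),
      (msetsOfWeight s S i).ncard * (msetsOfWeight s T (n - i)).ncard := by
  classical
  have hfin : ∀ i, (msetsOfWeight s S i ×ˢ msetsOfWeight s T (n - i)).Finite := fun i =>
    (finite_msetsOfWeight hs hS _).prod (finite_msetsOfWeight hs hT _)
  have hsub : msetsOfWeight s (S ∪ T) n ⊆ ⋃ i ∈ Finset.range (n + 1),
      (fun p : Multiset α × Multiset α => p.1 + p.2) ''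
        (msetsOfWeight s S i ×ˢ msetsOfWeight s T (n - i)) := by
    rintro H ⟨h1, h2⟩
    have hsplit := Multiset.filter_add_not (· ∈ S) H
    have hsum : ((H.filter (· ∈ S)).map s).sum + ((H.filter (¬ · ∈ S)).map s).sum = n := by
      rw [← h2, ← Multiset.sum_add, ← Multiset.map_add, hsplit]
    simp only [Set.mem_iUnion]
    refine ⟨((H.filter (· ∈ S)).map s).sum, Finset.mem_range.2 (by omega),
      (H.filter (· ∈ S), H.filter (¬ · ∈ S)), ⟨⟨fun a ha => (Multiset.mem_filter.1 ha).2, rfl⟩,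
        fun a ha => ?_, by dsimp only; omega⟩, hsplit⟩
    obtain ⟨ha1, ha2⟩ := Multiset.mem_filter.1 ha
    exact (h1 a ha1).resolve_left ha2
  refine (Set.ncard_le_ncard hsub
    ((Finset.range (n + 1)).finite_toSet.biUnion fun j _ => (hfin j).image _)).trans ?_
  refine (Finset.set_ncard_biUnion_le _ _).trans (Finset.sum_le_sum fun j _ => ?_)
  exact (Set.ncard_image_le (hfin j)).trans Set.ncard_prod.le

lemma msetsOfWeight_singleton_subsingleton {a : α} (ha : 0 < s a) (n : ℕ) :
    (msetsOfWeight s {a} n).Subsingleton := by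
  rintro H ⟨h1, h2⟩ H' ⟨h1', h2'⟩
  have e := Multiset.eq_replicate_card.2 h1
  have e' := Multiset.eq_replicate_card.2 h1'
  rw [e] at h2
  rw [e'] at h2'
  simp only [Multiset.map_replicate, Multiset.sum_replicate, smul_eq_mul] at h2 h2'
  rw [e, e', Nat.eq_of_mul_eq_mul_right ha (h2.trans h2'.symm)]

/-- Over a finite set of components, the number of multisets of weight `n` grows more slowly than
any exponential; the components are added one at a time. -/
lemma exists_ncard_msetsOfWeight_le_of_finite (hs : ∀ j, {a | s a = j}.Finite) {x : ℝ}
    (hx0 : 0 < x) (hx1 : x < 1) {S : Set α} (hSfin : S.Finite) (hS : ∀ a ∈ S, 0 < s a) :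
    ∃ A : ℝ, 0 ≤ A ∧ ∀ n, ((msetsOfWeight s S n).ncard : ℝ) ≤ A * x⁻¹ ^ n := by
  induction S, hSfin using Set.Finite.induction_on with
  | empty =>
    refine ⟨1, zero_le_one, fun n => ?_⟩
    have h : (msetsOfWeight s ∅ n).ncard ≤ 1 := by
      refine (Set.ncard_le_one (finite_msetsOfWeight hs (by simp) n)).2 ?_
      rintro H ⟨h1, -⟩ H' ⟨h1', -⟩
      rw [Multiset.eq_zero_of_forall_notMem h1, Multiset.eq_zero_of_forall_notMem h1']
    rw [one_mul]
    exact (by exact_mod_cast h : ((msetsOfWeight s ∅ n).ncard : ℝ) ≤ 1).trans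
      (one_le_pow₀ ((one_le_inv₀ hx0).2 hx1.le))
  | @insert a S _ _ ih =>
    obtain ⟨A, hA, hb⟩ := ih fun b hb => hS b (Set.mem_insert_of_mem a hb)
    have ha := hS a (Set.mem_insert a S)
    refine ⟨A * (1 - x)⁻¹, mul_nonneg hA (inv_nonneg.2 (by linarith)), fun n => ?_⟩
    have h1 := ncard_msetsOfWeight_union_le hs (S := {a}) (T := S) (by simpa using ha)
      (fun b hb => hS b (Set.mem_insert_of_mem a hb)) n
    rw [Set.singleton_union] at h1
    calc ((msetsOfWeight s (insert a S) n).ncard : ℝ)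
        ≤ ∑ i ∈ Finset.range (n + 1), ((msetsOfWeight s {a} i).ncard : ℝ) *
            ((msetsOfWeight s S (n - i)).ncard : ℝ) := by exact_mod_cast h1
      _ ≤ ∑ i ∈ Finset.range (n + 1), A * x⁻¹ ^ n * x ^ i := by
          refine Finset.sum_le_sum fun i hi => ?_
          have hin : i ≤ n := Nat.lt_succ_iff.1 (Finset.mem_range.1 hi)
          have h2 : ((msetsOfWeight s {a} i).ncard : ℝ) ≤ 1 := by
            exact_mod_cast (Set.ncard_le_one (finite_msetsOfWeight hs (by simpa using ha) i)).2
              fun _ h _ h' => msetsOfWeight_singleton_subsingleton ha i h h'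
          have h3 : x⁻¹ ^ n * x ^ i = x⁻¹ ^ (n - i) := by
            rw [inv_pow, inv_pow, ← Nat.sub_add_cancel hin, pow_add, Nat.sub_add_cancel hin]
            field_simp
          rw [mul_assoc, h3]
          calc _ ≤ 1 * (A * x⁻¹ ^ (n - i)) :=
                mul_le_mul h2 (hb _) (Nat.cast_nonneg _) zero_le_one
            _ = _ := one_mul _
      _ = A * x⁻¹ ^ n * ∑ i ∈ Finset.range (n + 1), x ^ i := by rw [Finset.mul_sum]
      _ ≤ A * x⁻¹ ^ n * (1 - x)⁻¹ := by
          refine mul_le_mul_of_nonneg_left ?_ (by positivity)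
          rw [← tsum_geometric_of_lt_one hx0.le hx1]
          exact (summable_geometric_of_lt_one hx0.le hx1).sum_le_tsum _
            fun i _ => by positivity
      _ = A * (1 - x)⁻¹ * x⁻¹ ^ n := by ring

end Multisets

/-! ### Subexponential sequences -/

section Sequences

variable {c : ℕ → ℝ} {ρ : ℝ}

lemma IsSubexponential.eventually_pos (hc : IsSubexponential c ρ) : ∀ᶠ n in atTop, 0 < c n := by
  filter_upwards [hc.tendsto_ratio.eventually (lt_mem_nhds hc.pos)] with n hn
  refine (hc.nonneg n).lt_of_ne' fun h => ?_
  simp [h] at hn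

/-- In a convolution square the summands at the two ends are reflections of each other. -/
lemma sum_range_conv_eq (c : ℕ → ℝ) {K n : ℕ} (hK : 2 * K ≤ n) :
    ∑ k ∈ Finset.range (n + 1), c k * c (n - k) =
      2 * ∑ k ∈ Finset.range K, c k * c (n - k) + ∑ k ∈ Finset.Icc K (n - K), c k * c (n - k) := by
  have h1 := Finset.sum_range_add_sum_Ico (fun k => c k * c (n - k)) (show K ≤ n + 1 by omega)
  have h2 := Finset.sum_Ico_consecutive (fun k => c k * c (n - k))
    (show K ≤ n + 1 - K by omega) (show n + 1 - K ≤ n + 1 by omega)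
  have h3 := Finset.sum_Ico_reflect (fun k => c k * c (n - k)) 0 (show K ≤ n + 1 by omega)
  have h4 : ∑ k ∈ Finset.Ico 0 K, c (n - k) * c (n - (n - k)) =
      ∑ k ∈ Finset.range K, c k * c (n - k) := by
    rw [Nat.Ico_zero_eq_range]
    refine Finset.sum_congr rfl fun k hk => ?_
    rw [Nat.sub_sub_self (by have := Finset.mem_range.1 hk; omega), mul_comm]
  have h5 : Finset.Ico K (n + 1 - K) = Finset.Icc K (n - K) := by
    ext k; simp; omega
  rw [h4] at h3
  rw [Nat.sub_zero] at h3
  rw [h5] at h2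
  rw [← h1, ← h2, ← h3]
  ring

lemma IsSubexponential.tendsto_sub_div (hc : IsSubexponential c ρ) (k : ℕ) :
    Tendsto (fun n => c (n - k) / c n) atTop (𝓝 (ρ ^ k)) := by
  induction k with
  | zero =>
    refine tendsto_const_nhds.congr' ?_
    filter_upwards [hc.eventually_pos] with n hn
    simp [hn.ne']
  | succ k ih =>
    have h1 : Tendsto (fun n => c (n - (k + 1)) / c (n - (k + 1) + 1)) atTop (𝓝 ρ) :=
      hc.tendsto_ratio.comp (tendsto_sub_atTop_nat (k + 1))
    rw [pow_succ']
    refine (h1.mul ih).congr' ?_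
    filter_upwards [(tendsto_sub_atTop_nat k).eventually hc.eventually_pos,
      eventually_ge_atTop (k + 1)] with n hn hk
    rw [show n - (k + 1) + 1 = n - k by omega]
    field_simp

/-- In the convolution square of a subexponential sequence, the summands in which both factors
have large index are negligible. -/
lemma IsSubexponential.exists_sum_Icc_le (hc : IsSubexponential c ρ) {ε : ℝ} (hε : 0 < ε) (K₀ : ℕ) :
    ∃ K ≥ K₀, ∀ᶠ n in atTop, ∑ k ∈ Finset.Icc K (n - K), c k * c (n - k) ≤ ε * c n := by
  have hsum : Tendsto (fun K => ∑ k ∈ Finset.range K, c k * ρ ^ k) atTop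
      (𝓝 (∑' k, c k * ρ ^ k)) := hc.summable.hasSum.tendsto_sum_nat
  obtain ⟨K, hK, hK0⟩ := ((hsum.eventually (lt_mem_nhds
    (show (∑' k, c k * ρ ^ k) - ε / 2 < _ by linarith))).and (eventually_ge_atTop K₀)).exists
  have h1 : Tendsto (fun n => ∑ k ∈ Finset.range K, c k * (c (n - k) / c n)) atTop
      (𝓝 (∑ k ∈ Finset.range K, c k * ρ ^ k)) :=
    tendsto_finsetSum _ fun k _ => (hc.tendsto_sub_div k).const_mul _
  have h2 := hc.tendsto_conv.sub (h1.const_mul 2)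
  refine ⟨K, hK0, ?_⟩
  filter_upwards [h2.eventually (gt_mem_nhds (show _ < ε by linarith)), hc.eventually_pos,
    eventually_ge_atTop (2 * K)] with n hn hpos hnK
  rw [sum_range_conv_eq c hnK] at hn
  have h3 : ∑ k ∈ Finset.range K, c k * (c (n - k) / c n) =
      (∑ k ∈ Finset.range K, c k * c (n - k)) / c n := by
    rw [Finset.sum_div]; exact Finset.sum_congr rfl fun k _ => by ring
  rw [h3, add_div, mul_div_assoc, add_sub_cancel_left] at hn
  exact ((div_lt_iff₀ hpos).1 hn).le

/-- The negligibility of the middle part of the convolution square is inherited by the sequence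
shifted by `m`, and one threshold serves for all `n`. -/
lemma IsSubexponential.exists_sum_Icc_shift_le (hc : IsSubexponential c ρ) (m : ℕ) {ε : ℝ}
    (hε : 0 < ε) (K₀ : ℕ) :
    ∃ K ≥ K₀, ∀ n, ∑ k ∈ Finset.Icc K (n - K), c (k + m) * c (n - k + m) ≤ ε * c (n + m) := by
  -- the shifted convolution at `n` is part of the convolution at `n + 2 * m`, and
  -- `c (n + 2 * m) / c (n + m)` tends to `ρ⁻¹ ^ m`
  have hρm : 0 < ρ ^ m := pow_pos hc.pos m
  obtain ⟨K, hK, hev⟩ := hc.exists_sum_Icc_le (show 0 < ε * (ρ ^ m / 2) by positivity) (K₀ + m)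
  obtain ⟨n₀, hn₀⟩ := eventually_atTop.1 (((tendsto_add_atTop_nat (2 * m)).eventually
    (hev.and (hc.eventually_pos.and ((hc.tendsto_sub_div m).eventually
      (lt_mem_nhds (show ρ ^ m / 2 < ρ ^ m by linarith)))))))
  refine ⟨K + n₀ + 1, by omega, fun n => ?_⟩
  rcases lt_or_ge n n₀ with hn | hn
  · rw [Finset.Icc_eq_empty (by omega), Finset.sum_empty]
    exact mul_nonneg hε.le (hc.nonneg _)
  obtain ⟨h1, h2, h3⟩ := hn₀ n hn
  rw [show n + 2 * m - m = n + m by omega, lt_div_iff₀ h2] at h3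
  calc ∑ k ∈ Finset.Icc (K + n₀ + 1) (n - (K + n₀ + 1)), c (k + m) * c (n - k + m)
      = ∑ k ∈ (Finset.Icc (K + n₀ + 1) (n - (K + n₀ + 1))).image (· + m),
          c k * c (n + 2 * m - k) := by
        rw [Finset.sum_image fun a _ b _ h => by simpa using h]
        refine Finset.sum_congr rfl fun k hk => ?_
        have := Finset.mem_Icc.1 hk
        rw [show n - k + m = n + 2 * m - (k + m) by omega]
    _ ≤ ∑ k ∈ Finset.Icc K (n + 2 * m - K), c k * c (n + 2 * m - k) := by
        refine Finset.sum_le_sum_of_subset_of_nonneg (fun k hk => ?_)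
          fun k _ _ => mul_nonneg (hc.nonneg _) (hc.nonneg _)
        simp only [Finset.mem_image, Finset.mem_Icc] at hk ⊢
        omega
    _ ≤ ε * (ρ ^ m / 2) * c (n + 2 * m) := h1
    _ ≤ ε * c (n + m) := by
        rw [mul_assoc]; exact mul_le_mul_of_nonneg_left h3.le hε.le

/-- A sequence of counts that is subexponential grows exponentially fast. -/
lemma IsSubexponential.lt_one {d : ℕ → ℕ} (hc : IsSubexponential (fun k => (d k : ℝ)) ρ) :
    ρ < 1 := by
  by_contra! h
  obtain ⟨n, h1, h2⟩ := (hc.eventually_pos.and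
    (hc.summable.tendsto_atTop_zero.eventually (gt_mem_nhds zero_lt_one))).exists
  have h3 : (1 : ℝ) ≤ d n := by exact_mod_cast h1
  nlinarith [one_le_pow₀ h (n := n)]

/-- If `d n / d (n + 1)` tends to `ρ < y`, then `d (n - i)` is at most of order `y ^ i * d n`,
uniformly in `i ≤ n`. -/
lemma exists_sub_le_of_tendsto_ratio {d : ℕ → ℕ} {y : ℝ} (hpos : ∀ᶠ n in atTop, 0 < d n)
    (hd : Tendsto (fun n => (d n : ℝ) / d (n + 1)) atTop (𝓝 ρ)) (hy0 : 0 < y) (hy1 : y < 1)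
    (hρ : ρ < y) :
    ∃ D : ℝ, 0 ≤ D ∧ ∃ J : ℕ, ∀ n ≥ J, ∀ i ≤ n, (d (n - i) : ℝ) + 1 ≤ D * y ^ i * d n := by
  obtain ⟨J, hJ⟩ := eventually_atTop.1 (hpos.and (hd.eventually (gt_mem_nhds hρ)))
  have hpos' : ∀ n ≥ J, (1 : ℝ) ≤ d n := fun n hn => by exact_mod_cast (hJ n hn).1
  have hstep : ∀ k ≥ J, ∀ i, (d k : ℝ) ≤ y ^ i * d (k + i) := by
    intro k hk i
    induction i with
    | zero => simp
    | succ i ih =>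
      have h1 := (hJ (k + i) (by omega)).2
      have h2 := hpos' (k + i + 1) (by omega)
      rw [div_lt_iff₀ (by linarith)] at h1
      calc (d k : ℝ) ≤ y ^ i * d (k + i) := ih
        _ ≤ y ^ i * (y * d (k + i + 1)) := by gcongr
        _ = _ := by rw [pow_succ, ← add_assoc]; ring
  set E : ℝ := ∑ k ∈ Finset.range J, (d k : ℝ) + 1 with hE
  have hE0 : 1 ≤ E := by
    have : 0 ≤ ∑ k ∈ Finset.range J, (d k : ℝ) := Finset.sum_nonneg fun _ _ => Nat.cast_nonneg _
    linarith
  refine ⟨2 + E / y ^ J, by positivity, J, fun n hn i hi => ?_⟩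
  have hdn := hpos' n hn
  have hyi : 0 < y ^ i := pow_pos hy0 i
  rcases le_or_gt J (n - i) with hk | hk
  · have h1 := hstep (n - i) hk i
    rw [Nat.sub_add_cancel hi] at h1
    have h2 := hpos' (n - i) hk
    have h3 : 0 ≤ E / y ^ J * (y ^ i * d n) := by positivity
    nlinarith
  · have h1 : (d (n - i) : ℝ) + 1 ≤ E := by
      rw [hE]
      gcongr
      exact Finset.single_le_sum (f := fun k => (d k : ℝ)) (fun _ _ => Nat.cast_nonneg _)
        (Finset.mem_range.2 hk)
    have h2 := hstep J le_rfl (n - J)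
    rw [Nat.add_sub_cancel' hn] at h2
    have h3 : y ^ (n - J) ≤ y ^ i / y ^ J := by
      rw [le_div_iff₀ (pow_pos hy0 J), ← pow_add, Nat.sub_add_cancel hn]
      exact pow_le_pow_of_le_one hy0.le hy1.le hi
    have h4 : 1 ≤ y ^ i / y ^ J * d n :=
      (hpos' J le_rfl).trans (h2.trans (mul_le_mul_of_nonneg_right h3 (Nat.cast_nonneg _)))
    have h5 : E ≤ E * (y ^ i / y ^ J * d n) := le_mul_of_one_le_right (by linarith) h4
    calc (d (n - i) : ℝ) + 1 ≤ E * (y ^ i / y ^ J * d n) := h1.trans h5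
      _ = E / y ^ J * y ^ i * d n := by ring
      _ ≤ (2 + E / y ^ J) * y ^ i * d n := by gcongr; linarith

end Sequences

/-! ### Multisets without a giant component are rare -/

section Giant

variable {α : Type*} {s : α → ℕ}

lemma ncard_msetsOfWeight_zero_le (hs : ∀ j, {a | s a = j}.Finite) {S : Set α}
    (hS : ∀ a ∈ S, 0 < s a) : (msetsOfWeight s S 0).ncard ≤ 1 := by
  have h0 : ∀ H ∈ msetsOfWeight s S 0, H = 0 := by
    rintro H ⟨h1, h2⟩
    have := card_le_sum_map fun a ha => hS a (h1 a ha)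
    exact Multiset.card_eq_zero.1 (by omega)
  exact (Set.ncard_le_one (finite_msetsOfWeight hs hS 0)).2 fun H h H' h' => by
    rw [h0 H h, h0 H' h']

/-- If all components are so large that the middle part of the convolution square of the counting
sequence is small, then at least half of the multisets of weight `n` are single components: after
removing one component, the rest is empty or again of weight at least `K`. -/
lemma ncard_msetsOfWeight_ge_le (hs : ∀ j, {a | s a = j}.Finite) {K : ℕ} (hK : 0 < K)
    (hmid : ∀ n, ∑ k ∈ Finset.Icc K (n - K), ({a | s a = k}.ncard : ℝ) * {a | s a = n - k}.ncard ≤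
      1 / 2 * {a | s a = n}.ncard) {n : ℕ} (hn : 0 < n) :
    ((msetsOfWeight s {a | K ≤ s a} n).ncard : ℝ) ≤ 2 * {a | s a = n}.ncard := by
  have hS : ∀ a ∈ {a | K ≤ s a}, 0 < s a := fun a ha => hK.trans_le ha
  induction n using Nat.strong_induction_on with
  | _ n ih =>
    have hex : ∀ H ∈ msetsOfWeight s {a | K ≤ s a} n,
        ∃ a ∈ H, s a ∈ insert n (Finset.Icc K (n - K)) := by
      rintro H ⟨h1, h2⟩
      have hH : H ≠ 0 := by rintro rfl; simp at h2; omega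
      obtain ⟨a, ha⟩ := Multiset.exists_mem_of_ne_zero hH
      refine ⟨a, ha, ?_⟩
      obtain ⟨H', rfl⟩ := Multiset.exists_cons_of_mem ha
      have hKa : K ≤ s a := h1 a ha
      rw [Multiset.map_cons, Multiset.sum_cons] at h2
      rw [Finset.mem_insert, Finset.mem_Icc]
      rcases Multiset.empty_or_exists_mem H' with rfl | ⟨b, hb⟩
      · left; simpa using h2
      · have hKb : K ≤ s b := h1 b (Multiset.mem_cons_of_mem hb)
        have := le_sum_map (s := s) hb
        omega
    have h1 := ncard_le_sum_remove hs hS subset_rfl _ hex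
    rw [Finset.sum_insert (by simp; omega), Nat.sub_self] at h1
    have h0 := ncard_msetsOfWeight_zero_le hs hS
    calc ((msetsOfWeight s {a | K ≤ s a} n).ncard : ℝ)
        ≤ {a | s a = n}.ncard * (msetsOfWeight s {a | K ≤ s a} 0).ncard +
          ∑ k ∈ Finset.Icc K (n - K), ({a | s a = k}.ncard : ℝ) *
            (msetsOfWeight s {a | K ≤ s a} (n - k)).ncard := by exact_mod_cast h1
      _ ≤ {a | s a = n}.ncard * 1 + ∑ k ∈ Finset.Icc K (n - K), ({a | s a = k}.ncard : ℝ) *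
            (2 * {a | s a = n - k}.ncard) := by
          refine add_le_add ?_ (Finset.sum_le_sum fun k hk => ?_)
          · gcongr; exact_mod_cast h0
          · have := Finset.mem_Icc.1 hk
            gcongr
            exact ih (n - k) (by omega) (by omega)
      _ = {a | s a = n}.ncard + 2 * ∑ k ∈ Finset.Icc K (n - K), ({a | s a = k}.ncard : ℝ) *
            {a | s a = n - k}.ncard := by
          rw [mul_one, Finset.mul_sum]
          exact congrArg _ (Finset.sum_congr rfl fun k _ => by ring)
      _ ≤ _ := by linarith [hmid n]

variable {x y D : ℝ} {J : ℕ}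

/-- The number of multisets of weight `n` is of the order of the number of single components of
weight `n`: the components of weight below a threshold contribute a generating function that
converges beyond the radius `y`, and multisets of the others are about as numerous as single
components. -/
lemma exists_ncard_msetsOfWeight_le (hs : ∀ j, {a | s a = j}.Finite) {K : ℕ} (hK : 0 < K)
    (hmid : ∀ n, ∑ k ∈ Finset.Icc K (n - K), ({a | s a = k}.ncard : ℝ) * {a | s a = n - k}.ncard ≤
      1 / 2 * {a | s a = n}.ncard) (hy0 : 0 < y) (hyx : y < x) (hx1 : x < 1) (hD : 0 ≤ D)
    (hgrow : ∀ n ≥ J, ∀ i ≤ n,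
      ({a | s a = n - i}.ncard : ℝ) + 1 ≤ D * y ^ i * {a | s a = n}.ncard) :
    ∃ A : ℝ, 0 ≤ A ∧ ∀ n ≥ J,
      ((msetsOfWeight s {a | 0 < s a} n).ncard : ℝ) ≤ A * {a | s a = n}.ncard := by
  have hx0 : 0 < x := hy0.trans hyx
  have hr0 : 0 ≤ y / x := by positivity
  have hr1 : y / x < 1 := (div_lt_one hx0).2 hyx
  obtain ⟨A, hA, hsmall⟩ := exists_ncard_msetsOfWeight_le_of_finite hs hx0 hx1
    (S := {a | 0 < s a ∧ s a < K}) ((finite_weight_le hs K).subset fun a ha => ha.2.le)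
    fun a ha => ha.1
  have hT : ∀ a ∈ {a | K ≤ s a}, 0 < s a := fun a ha => hK.trans_le ha
  have hlarge : ∀ n, ((msetsOfWeight s {a | K ≤ s a} n).ncard : ℝ) ≤
      2 * ({a | s a = n}.ncard + 1) := by
    intro n
    rcases Nat.eq_zero_or_pos n with rfl | hn
    · have h0 : ((msetsOfWeight s {a | K ≤ s a} 0).ncard : ℝ) ≤ 1 := by
        exact_mod_cast ncard_msetsOfWeight_zero_le hs hT
      have : (0 : ℝ) ≤ {a | s a = 0}.ncard := Nat.cast_nonneg _
      linarith
    · linarith [ncard_msetsOfWeight_ge_le hs hK hmid hn]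
  refine ⟨2 * A * D * (1 - y / x)⁻¹,
    mul_nonneg (by positivity) (inv_nonneg.2 (by linarith)), fun n hn => ?_⟩
  have hunion : {a | 0 < s a} = {a | 0 < s a ∧ s a < K} ∪ {a | K ≤ s a} := by
    ext a; simp only [Set.mem_ofPred_eq, Set.mem_union]; omega
  have h1 := ncard_msetsOfWeight_union_le hs (S := {a | 0 < s a ∧ s a < K}) (fun a ha => ha.1) hT n
  rw [← hunion] at h1
  calc ((msetsOfWeight s {a | 0 < s a} n).ncard : ℝ)
      ≤ ∑ i ∈ Finset.range (n + 1), ((msetsOfWeight s {a | 0 < s a ∧ s a < K} i).ncard : ℝ) *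
          (msetsOfWeight s {a | K ≤ s a} (n - i)).ncard := by exact_mod_cast h1
    _ ≤ ∑ i ∈ Finset.range (n + 1), (2 * A * D * {a | s a = n}.ncard) * (y / x) ^ i := by
        refine Finset.sum_le_sum fun i hi => ?_
        have h2 := hgrow n hn i (Nat.lt_succ_iff.1 (Finset.mem_range.1 hi))
        calc _ ≤ A * x⁻¹ ^ i * (2 * (D * y ^ i * {a | s a = n}.ncard)) :=
              mul_le_mul (hsmall i) ((hlarge _).trans (by linarith)) (Nat.cast_nonneg _)
                (by positivity)
          _ = _ := by rw [div_eq_mul_inv, mul_pow]; ring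
    _ = (2 * A * D * {a | s a = n}.ncard) * ∑ i ∈ Finset.range (n + 1), (y / x) ^ i := by
        rw [Finset.mul_sum]
    _ ≤ (2 * A * D * {a | s a = n}.ncard) * (1 - y / x)⁻¹ := by
        refine mul_le_mul_of_nonneg_left ?_ (by positivity)
        rw [← tsum_geometric_of_lt_one hr0 hr1]
        exact (summable_geometric_of_lt_one hr0 hr1).sum_le_tsum _ fun i _ => by positivity
    _ = _ := by ring

/-- Compared with the single components of weight `n`, the multisets of weight `n` all of whose
components have weight at most `n - K` are rare. -/
lemma exists_ncard_no_giant_le (hs : ∀ j, {a | s a = j}.Finite)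
    (hmid : ∀ ε : ℝ, 0 < ε → ∀ K₀ : ℕ, ∃ K ≥ K₀, ∀ n, ∑ k ∈ Finset.Icc K (n - K),
      ({a | s a = k}.ncard : ℝ) * {a | s a = n - k}.ncard ≤ ε * {a | s a = n}.ncard)
    (hy0 : 0 < y) (hyx : y < x) (hx1 : x < 1) (hD : 0 ≤ D)
    (hgrow : ∀ n ≥ J, ∀ i ≤ n,
      ({a | s a = n - i}.ncard : ℝ) + 1 ≤ D * y ^ i * {a | s a = n}.ncard)
    {ε : ℝ} (hε : 0 < ε) :
    ∃ K : ℕ, ∀ᶠ n in atTop,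
      ({H ∈ msetsOfWeight s {a | 0 < s a} n | ∀ a ∈ H, s a + K ≤ n}.ncard : ℝ) ≤
        ε * {a | s a = n}.ncard := by
  have hx0 : 0 < x := hy0.trans hyx
  have hS : ∀ a ∈ {a | 0 < s a}, 0 < s a := fun a ha => ha
  obtain ⟨K', hK', hmid'⟩ := hmid (1 / 2) (by norm_num) 1
  obtain ⟨A, hA, hall⟩ := exists_ncard_msetsOfWeight_le hs hK' hmid' hy0 hyx hx1 hD hgrow
  obtain ⟨K, hK, hmidK⟩ := hmid (ε / (2 * (A + 1))) (by positivity) (J + 1)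
  obtain ⟨B, hB, hsmall⟩ := exists_ncard_msetsOfWeight_le_of_finite hs hx0 hx1
    (S := {a | 0 < s a ∧ s a < K}) ((finite_weight_le hs K).subset fun a ha => ha.2.le)
    fun a ha => ha.1
  have hlim : Tendsto (fun n => B * D * (y / x) ^ n) atTop (𝓝 (B * D * 0)) :=
    (tendsto_pow_atTop_nhds_zero_of_lt_one (by positivity) ((div_lt_one hx0).2 hyx)).const_mul _
  refine ⟨K, ?_⟩
  filter_upwards [hlim.eventually (gt_mem_nhds (show B * D * 0 < ε / 2 by simpa using hε)),
    eventually_ge_atTop J] with n hn hJ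
  set X : Set (Multiset α) := {H ∈ msetsOfWeight s {a | 0 < s a} n | ∀ a ∈ H, s a + K ≤ n}
  set Y : Set (Multiset α) := {H ∈ X | ∃ a ∈ H, K ≤ s a}
  have hYW : Y ⊆ msetsOfWeight s {a | 0 < s a} n := fun H hH => hH.1.1
  have hsub : X ⊆ msetsOfWeight s {a | 0 < s a ∧ s a < K} n ∪ Y := by
    intro H hH
    by_cases h : ∃ a ∈ H, K ≤ s a
    · exact Or.inr ⟨hH, h⟩
    · push Not at h
      exact Or.inl ⟨fun a ha => ⟨hH.1.1 a ha, h a ha⟩, hH.1.2⟩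
  have hX : X.ncard ≤ (msetsOfWeight s {a | 0 < s a ∧ s a < K} n).ncard + Y.ncard :=
    (Set.ncard_le_ncard hsub ((finite_msetsOfWeight hs (fun a ha => ha.1) n).union
      ((finite_msetsOfWeight hs hS n).subset hYW))).trans (Set.ncard_union_le _ _)
  have hY : (Y.ncard : ℝ) ≤ ε / 2 * {a | s a = n}.ncard := by
    have h1 := ncard_le_sum_remove hs hS hYW (Finset.Icc K (n - K)) (by
      rintro H ⟨h1, a, ha, hKa⟩
      have := h1.2 a ha
      exact ⟨a, ha, Finset.mem_Icc.2 (by omega)⟩)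
    calc (Y.ncard : ℝ) ≤ ∑ k ∈ Finset.Icc K (n - K), ({a | s a = k}.ncard : ℝ) *
          (msetsOfWeight s {a | 0 < s a} (n - k)).ncard := by exact_mod_cast h1
      _ ≤ ∑ k ∈ Finset.Icc K (n - K), ({a | s a = k}.ncard : ℝ) *
          (A * {a | s a = n - k}.ncard) := by
          refine Finset.sum_le_sum fun k hk => ?_
          have := Finset.mem_Icc.1 hk
          gcongr
          exact hall (n - k) (by omega)
      _ = A * ∑ k ∈ Finset.Icc K (n - K), ({a | s a = k}.ncard : ℝ) *
          {a | s a = n - k}.ncard := by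
          rw [Finset.mul_sum]; exact Finset.sum_congr rfl fun k _ => by ring
      _ ≤ (A + 1) * (ε / (2 * (A + 1)) * {a | s a = n}.ncard) := by
          refine mul_le_mul (by linarith) (hmidK n) (by positivity) (by positivity)
      _ = _ := by field_simp
  have hZ : ((msetsOfWeight s {a | 0 < s a ∧ s a < K} n).ncard : ℝ) ≤
      ε / 2 * {a | s a = n}.ncard := by
    have h1 : 1 ≤ D * y ^ n * ({a | s a = n}.ncard : ℝ) := by
      refine le_trans ?_ (hgrow n hJ n le_rfl)
      linarith [(Nat.cast_nonneg _ : (0 : ℝ) ≤ {a | s a = n - n}.ncard)]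
    calc _ ≤ B * x⁻¹ ^ n := hsmall n
      _ ≤ B * x⁻¹ ^ n * (D * y ^ n * ({a | s a = n}.ncard : ℝ)) :=
          le_mul_of_one_le_right (by positivity) h1
      _ = B * D * (y / x) ^ n * {a | s a = n}.ncard := by
          rw [div_eq_mul_inv, mul_pow]; ring
      _ ≤ _ := by gcongr
  have hX' : (X.ncard : ℝ) ≤ (msetsOfWeight s {a | 0 < s a ∧ s a < K} n).ncard + Y.ncard := by
    exact_mod_cast hX
  linarith

end Giant

/-! ### Multisets with a prescribed number of components -/

instance (α : Type*) : DiscreteMeasurableSpace (Multiset α) := ⟨fun _ => trivial⟩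

lemma uniformOn_real_eq {Ω : Type*} [MeasurableSpace Ω] [DiscreteMeasurableSpace Ω] {S : Set Ω}
    (hS : S.Finite) (T : Set Ω) : (uniformOn S).real T = (S ∩ T).ncard / S.ncard := by
  rw [measureReal_def, uniformOn, cond_apply hS.measurableSet, Measure.count_apply_finite _ hS,
    Measure.count_apply_finite _ (hS.inter_of_left T), ENNReal.toReal_mul, ENNReal.toReal_inv,
    ENNReal.toReal_natCast, ENNReal.toReal_natCast, ← Set.ncard_eq_toFinset_card _ hS,
    ← Set.ncard_eq_toFinset_card _ (hS.inter_of_left T)]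
  ring

namespace CombClass

variable (C : CombClass)

/-- The size of an object in excess of the minimal size. -/
noncomputable def excess (a : C.Obj) : ℕ := C.size a - C.minSize

/-- The multisets consisting of `k` objects of minimal size. -/
def minMsets (k : ℕ) : Set (Multiset C.Obj) :=
  {H | (∀ a ∈ H, C.size a = C.minSize) ∧ Multiset.card H = k}

lemma count_size_pos (a : C.Obj) : 0 < C.count (C.size a) :=
  (Set.ncard_pos (C.finite_size_eq _)).2 ⟨a, rfl⟩

lemma minSize_le (a : C.Obj) : C.minSize ≤ C.size a := Nat.sInf_le (C.count_size_pos a)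

lemma excess_add (a : C.Obj) : C.excess a + C.minSize = C.size a :=
  Nat.sub_add_cancel (C.minSize_le a)

lemma setOf_excess_eq (j : ℕ) : {a | C.excess a = j} = {a | C.size a = j + C.minSize} := by
  ext a
  have := C.excess_add a
  simp only [Set.mem_ofPred_eq]
  omega

lemma finite_excess_eq (j : ℕ) : {a | C.excess a = j}.Finite := by
  rw [C.setOf_excess_eq]; exact C.finite_size_eq _

lemma ncard_excess_eq (j : ℕ) : {a | C.excess a = j}.ncard = C.count (j + C.minSize) := by
  rw [C.setOf_excess_eq, count]

lemma exists_size_eq_minSize {k : ℕ} (hk : 0 < C.count k) : ∃ a, C.size a = C.minSize :=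
  (Set.ncard_pos (C.finite_size_eq _)).1 (Nat.sInf_mem (s := {k | 0 < C.count k}) ⟨k, hk⟩)

lemma totalSize_eq (G : Multiset C.Obj) :
    C.totalSize G = (G.map C.excess).sum + C.minSize * Multiset.card G := by
  rw [totalSize, Multiset.map_congr rfl fun a _ => (C.excess_add a).symm, Multiset.sum_map_add]
  simp [mul_comm]

lemma finite_minMsets (k : ℕ) : (C.minMsets k).Finite :=
  (finite_multiset_card_le (C.finite_size_eq C.minSize) k).subset fun _ hH => ⟨hH.1, hH.2.le⟩

lemma finite_msets (n N : ℕ) : (C.msets n N).Finite :=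
  (finite_multiset_card_le (finite_weight_le C.finite_size_eq n) N).subset fun _ hH =>
    ⟨fun _ ha => hH.1 ▸ le_sum_map ha, hH.2.le⟩

lemma minMsets_nonempty {a : C.Obj} (ha : C.size a = C.minSize) (k : ℕ) :
    (C.minMsets k).Nonempty :=
  ⟨Multiset.replicate k a, fun b hb => by rw [Multiset.eq_of_mem_replicate hb, ha], by simp⟩

/-- Adding one object of excess `M > 0` to objects of minimal size is injective. -/
lemma count_mul_ncard_minMsets_le {M : ℕ} (hM : 0 < M) (N : ℕ) :
    C.count (M + C.minSize) * (C.minMsets N).ncard ≤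
      (C.msets (M + C.minSize * (N + 1)) (N + 1)).ncard := by
  rw [count, ← Set.ncard_prod]
  refine Set.ncard_le_ncard_of_injOn (fun p => p.1 ::ₘ p.2) ?_ ?_ (C.finite_msets _ _)
  · rintro ⟨a, H⟩ ⟨ha, h1, h2⟩
    refine ⟨?_, by simpa using h2⟩
    have h3 : (H.map C.size).sum = C.minSize * N := by
      rw [Multiset.map_congr rfl h1]; simp [h2, mul_comm]
    have ha : C.size a = M + C.minSize := ha
    simp only [totalSize, Multiset.map_cons, Multiset.sum_cons, h3, ha]
    ring
  · rintro ⟨a, H⟩ ⟨ha, -⟩ ⟨b, H'⟩ ⟨-, h1', -⟩ hab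
    have hab : a ::ₘ H = b ::ₘ H' := hab
    have ha : C.size a = M + C.minSize := ha
    have h1' : ∀ a ∈ H', C.size a = C.minSize := h1'
    have hmem : a ∈ b ::ₘ H' := hab ▸ Multiset.mem_cons_self a H
    obtain rfl : a = b := (Multiset.mem_cons.1 hmem).resolve_right fun h => by
      have := h1' a h
      omega
    rw [(Multiset.cons_inj_right a).1 hab]

/-- A multiset of `N + 1` objects with total excess `M > 0` is determined by its components of
positive excess, of which there is at least one, and its components of minimal size, whose number
is raised to `N` by repeating one fixed object. -/
lemma ncard_msets_excess_le {z : C.Obj} (hz : C.size z = C.minSize) {M : ℕ} (hM : 0 < M)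
    (N K : ℕ) :
    {G ∈ C.msets (M + C.minSize * (N + 1)) (N + 1) | ∀ a ∈ G, C.excess a + K ≤ M}.ncard ≤
      {H ∈ msetsOfWeight C.excess {a | 0 < C.excess a} M | ∀ a ∈ H, C.excess a + K ≤ M}.ncard *
        (C.minMsets N).ncard := by
  classical
  rw [← Set.ncard_prod]
  refine Set.ncard_le_ncard_of_injOn (fun G => (G.filter (0 < C.excess ·),
    G.filter (¬ 0 < C.excess ·) +
      Multiset.replicate (Multiset.card (G.filter (0 < C.excess ·)) - 1) z)) ?_ ?_
    (((finite_msetsOfWeight C.finite_excess_eq (fun _ h => h) M).subset fun _ h => h.1).prod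
      (C.finite_minMsets N))
  · rintro G ⟨⟨h1, h2⟩, h3⟩
    have hsplit := Multiset.filter_add_not (0 < C.excess ·) G
    have hsum : (G.map C.excess).sum = M := by
      rw [totalSize_eq, h2] at h1; omega
    have hsum' : ((G.filter (0 < C.excess ·)).map C.excess).sum = M := by
      have h4 : ((G.filter (¬ 0 < C.excess ·)).map C.excess).sum = 0 := by
        refine Multiset.sum_eq_zero fun x hx => ?_
        obtain ⟨a, ha, rfl⟩ := Multiset.mem_map.1 hx
        have := (Multiset.mem_filter.1 ha).2
        omega
      rw [← hsplit, Multiset.map_add, Multiset.sum_add, h4, add_zero] at hsum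
      exact hsum
    have hcard : Multiset.card (G.filter (0 < C.excess ·)) +
        Multiset.card (G.filter (¬ 0 < C.excess ·)) = N + 1 := by
      rw [← Multiset.card_add, hsplit, h2]
    have hpos : 0 < Multiset.card (G.filter (0 < C.excess ·)) := by
      refine Multiset.card_pos.2 fun h => ?_
      rw [h] at hsum'
      simp at hsum'
      omega
    refine ⟨⟨⟨fun a ha => (Multiset.mem_filter.1 ha).2, hsum'⟩,
      fun a ha => h3 a (Multiset.mem_filter.1 ha).1⟩, fun a ha => ?_, ?_⟩
    · rcases Multiset.mem_add.1 ha with ha | ha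
      · have := (Multiset.mem_filter.1 ha).2
        have := C.excess_add a
        omega
      · rw [Multiset.eq_of_mem_replicate ha, hz]
    · rw [Multiset.card_add, Multiset.card_replicate]
      omega
  · intro G _ G' _ h
    obtain ⟨h1, h2⟩ := Prod.mk.inj h
    rw [h1] at h2
    rw [← Multiset.filter_add_not (0 < C.excess ·) G, h1, add_right_cancel h2,
      Multiset.filter_add_not]

/-- If the size of the largest component differs from the total excess `M` by more than the minimal
size plus `K`, then all components have excess at most `M - K`. -/
lemma excess_add_le_of_le_abs {M N K : ℕ} {G : Multiset C.Obj}
    (hG : G ∈ C.msets (M + C.minSize * N) N)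
    (h : (K : ℝ) + C.minSize + 1 ≤ |(C.largest G : ℝ) - M|) {a : C.Obj} (ha : a ∈ G) :
    C.excess a + K ≤ M := by
  obtain ⟨h1, h2⟩ := hG
  have hsum : (G.map C.excess).sum = M := by
    rw [totalSize_eq, h2] at h1; omega
  have hle : C.largest G ≤ M + C.minSize := by
    refine Multiset.sup_le.2 fun x hx => ?_
    obtain ⟨b, hb, rfl⟩ := Multiset.mem_map.1 hx
    have := le_sum_map (s := C.excess) hb
    have := C.excess_add b
    omega
  have hsize : C.size a ≤ C.largest G := Multiset.le_sup (Multiset.mem_map_of_mem _ ha)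
  have hexc := C.excess_add a
  have hle' : (C.largest G : ℝ) ≤ M + C.minSize := by exact_mod_cast hle
  rcases le_abs.1 h with h | h
  · have : (0 : ℝ) ≤ K := Nat.cast_nonneg K
    linarith
  · have h3 : K + C.minSize + 1 + C.largest G ≤ M := by
      rw [← Nat.cast_le (α := ℝ)]
      push_cast
      linarith
    omega

end CombClass

lemma eventually_jointlyToInfinity (m B : ℕ) :
    ∀ᶠ p in jointlyToInfinity m, ∃ M N, B ≤ M ∧ p = (M + m * (N + 1), N + 1) := by
  have h1 : ∀ᶠ p : ℕ × ℕ in jointlyToInfinity m, 1 ≤ p.2 :=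
    (tendsto_comap.mono_left (inf_le_left.trans inf_le_right)).eventually (eventually_ge_atTop 1)
  have h2 : ∀ᶠ p : ℕ × ℕ in jointlyToInfinity m, (B : ℤ) ≤ (p.1 : ℤ) - (m : ℤ) * (p.2 : ℤ) :=
    (tendsto_comap.mono_left inf_le_right).eventually (eventually_ge_atTop (B : ℤ))
  filter_upwards [h1, h2] with ⟨n, N⟩ hN hn
  have hn' : B + m * N ≤ n := by
    zify
    dsimp only at hn
    linarith
  refine ⟨n - m * N, N - 1, by omega, ?_⟩
  rw [Nat.sub_add_cancel hN, Nat.sub_add_cancel (by omega)]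

theorem theorem3 (C : CombClass) (ρ : ℝ)
    (hC : IsSubexponential (fun k => (C.count k : ℝ)) ρ) :
    (∀ᶠ p in jointlyToInfinity C.minSize, IsProbabilityMeasure (C.uniformLaw p.1 p.2)) ∧
    IsBoundedInProbability (jointlyToInfinity C.minSize)
      (fun p => C.uniformLaw p.1 p.2)
      (fun p G => (C.largest G : ℝ) - ((p.1 : ℝ) - (C.minSize : ℝ) * (p.2 : ℝ))) := by
  have hpos : ∀ᶠ n in atTop, 0 < C.count n := hC.eventually_pos.mono fun n hn => by
    exact_mod_cast hn
  have hpos' : ∀ᶠ n in atTop, 0 < C.count (n + C.minSize) :=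
    (tendsto_add_atTop_nat C.minSize).eventually hpos
  obtain ⟨z, hz⟩ := C.exists_size_eq_minSize hpos.exists.choose_spec
  have hmin : ∀ N, 0 < (C.minMsets N).ncard := fun N =>
    (Set.ncard_pos (C.finite_minMsets N)).2 (C.minMsets_nonempty hz N)
  have hcard : ∀ {M : ℕ}, 0 < M → 0 < C.count (M + C.minSize) → ∀ N,
      0 < (C.msets (M + C.minSize * (N + 1)) (N + 1)).ncard := fun hM hM' N =>
    (Nat.mul_pos hM' (hmin N)).trans_le (C.count_mul_ncard_minMsets_le hM N)
  obtain ⟨B, hB⟩ := eventually_atTop.1 hpos'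
  constructor
  · filter_upwards [eventually_jointlyToInfinity C.minSize (B + 1)]
    rintro _ ⟨M, N, hM, rfl⟩
    exact isProbabilityMeasure_uniformOn (C.finite_msets _ _)
      ((Set.ncard_pos (C.finite_msets _ _)).1 (hcard (by omega) (hB M (by omega)) N))
  · intro ε hε
    -- two radii `ρ < y < x < 1`
    obtain ⟨y, hρy, hy1⟩ := exists_between hC.lt_one
    obtain ⟨x, hyx, hx1⟩ := exists_between hy1
    have hy0 := hC.pos.trans hρy
    have hratio : Tendsto (fun n => (C.count (n + C.minSize) : ℝ) / C.count (n + 1 + C.minSize))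
        atTop (𝓝 ρ) := by
      refine (hC.tendsto_ratio.comp (tendsto_add_atTop_nat C.minSize)).congr fun n => ?_
      simp only [Function.comp_apply, add_right_comm n C.minSize 1]
    obtain ⟨D, hD, J, hgrow⟩ := exists_sub_le_of_tendsto_ratio
      (d := fun n => C.count (n + C.minSize)) hpos' hratio hy0 hy1 hρy
    obtain ⟨K, hK⟩ := exists_ncard_no_giant_le (s := C.excess) C.finite_excess_eq
      (by simpa only [C.ncard_excess_eq] using
        fun ε hε => hC.exists_sum_Icc_shift_le C.minSize (ε := ε) hε)
      hy0 hyx hx1 hD (J := J) (by simpa only [C.ncard_excess_eq] using hgrow) hε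
    obtain ⟨B', hB'⟩ := eventually_atTop.1 hK
    refine ⟨K + C.minSize + 1, by positivity, ?_⟩
    filter_upwards [eventually_jointlyToInfinity C.minSize (B + B' + 1)]
    rintro _ ⟨M, N, hM, rfl⟩
    have h1 := hB' M (by omega)
    rw [C.ncard_excess_eq] at h1
    have hM0 : 0 < M := by omega
    have h2 := C.count_mul_ncard_minMsets_le hM0 N
    have h3 := C.ncard_msets_excess_le hz hM0 N K
    have hfin := C.finite_msets (M + C.minSize * (N + 1)) (N + 1)
    have h4 : (C.msets (M + C.minSize * (N + 1)) (N + 1) ∩ {G | (K : ℝ) + C.minSize + 1 ≤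
        |(C.largest G : ℝ) - (((M + C.minSize * (N + 1) : ℕ) : ℝ) -
          (C.minSize : ℝ) * ((N + 1 : ℕ) : ℝ))|}).ncard ≤
        {G ∈ C.msets (M + C.minSize * (N + 1)) (N + 1) | ∀ a ∈ G, C.excess a + K ≤ M}.ncard := by
      refine Set.ncard_le_ncard ?_ (hfin.subset fun _ h => h.1)
      rintro G ⟨hG, hGK⟩
      refine ⟨hG, fun a ha => C.excess_add_le_of_le_abs hG ?_ ha⟩
      rw [Set.mem_ofPred_eq] at hGK
      push_cast at hGK
      rwa [add_sub_cancel_right] at hGK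
    dsimp only [CombClass.uniformLaw]
    rw [uniformOn_real_eq hfin, div_le_iff₀ (by exact_mod_cast hcard hM0 (hB M (by omega)) N)]
    calc _ ≤ (({H ∈ msetsOfWeight C.excess {a | 0 < C.excess a} M |
              ∀ a ∈ H, C.excess a + K ≤ M}.ncard : ℝ) * (C.minMsets N).ncard) := by
          exact_mod_cast h4.trans h3
      _ ≤ ε * C.count (M + C.minSize) * (C.minMsets N).ncard := by gcongr
      _ = ε * ((C.count (M + C.minSize) * (C.minMsets N).ncard : ℕ) : ℝ) := by push_cast; ring
      _ ≤ _ := by gcongr
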